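/- Let $p$ be a prime, let $L$ be a finite extension of $\mathbb{Q}_p$ with the norm extending the $p$-adic one, and let $K=\mathrm{GL}_2(\mathbb{Z}_p)$. Let $\mathcal C(K,L)$ be the $L$-Banach space of continuous functions $K\to L$ with the supremum norm, on which $K$ acts by right translations $(hf)(g)=f(gh)$. For $l\in\mathbb Z$ and an integer $k\ge 1$ let $V_{l,k}=\det^l\otimes\mathrm{Sym}^{k-1}L^2$, realized on the homogeneous polynomials of degree $k-1$ in $L[x,y]$ with the action $$\begin{pmatrix} a& b\\ c& d\end{pmatrix}P(x,y)=(ad-bc)^l\,P(ax+cy,\,bx+dy).$$ Let $(E,\|\cdot\|)$ be a unitary $L$-Banach space representation of $K$, that is, an $L$-Banach space with non-archimedean norm and a continuous $L$-linear action $K\times E\to E$ which preserves the norm. Suppose that, for some integer $r\ge 0$, $E$ is isomorphic, by a $K$-equivariant topological isomorphism, to a direct summand of $\mathcal C(K,L)^{\oplus r}$ (a closed $K$-stable subspace with a closed $K$-stable complement). A vector $v\in E$ is called $K$-algebraic if there are a finite dimensional algebraic representation $W$ of $\mathrm{GL}_2$ over $L$ and a $K$-equivariant $L$-linear map $W\to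 E$ whose image contains $v$. Then: 1. the evaluation map $$\bigoplus_{(l,k)\in\mathbb Z\times\mathbb Z_{\ge 1}}\mathrm{Hom}_K(V_{l,k},E)\otimes_L V_{l,k}\longrightarrow E,\qquad \varphi\otimes v\mapsto\varphi(v),$$ is injective; 2. its image is equal to the set of $K$-algebraic vectors of $E$; 3. its image is dense in $E$; 4. for all $l\in\mathbb Z$ and $k\ge 1$ the $L$-vector space $\mathrm{Hom}_K(V_{l,k},E)$ is finite dimensional. -/

import Mathlib

open scoped TensorProduct DirectSum

namespace KAlg

universe u

/-- The group `K = GL₂(ℤ_p)`, with the topology of the unit group of `M₂(ℤ_p)`. -/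
abbrev K (p : ℕ) [Fact p.Prime] : Type := Matrix.GeneralLinearGroup (Fin 2) ℤ_[p]

/-- The inclusion `ℤ_p ⊆ ℚ_p ⊆ L`. -/
noncomputable def intToField (p : ℕ) [Fact p.Prime] (L : Type u) [NontriviallyNormedField L]
    [NormedAlgebra ℚ_[p] L] : ℤ_[p] →+* L :=
  (algebraMap ℚ_[p] L).comp PadicInt.Coe.ringHom

/-- The inclusion `GL₂(ℤ_p) ⊆ GL₂(L)`. -/
noncomputable def incl (p : ℕ) [Fact p.Prime] (L : Type u) [NontriviallyNormedField L]
    [NormedAlgebra ℚ_[p] L] : K p →* Matrix.GeneralLinearGroup (Fin 2) L :=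
  Matrix.GeneralLinearGroup.map (intToField p L)

/-- The restriction to `K = GL₂(ℤ_p)` of a representation of `GL₂(L)`. -/
noncomputable def resK (p : ℕ) [Fact p.Prime] {L : Type u} [NontriviallyNormedField L]
    [NormedAlgebra ℚ_[p] L] {W : Type u} [AddCommGroup W] [Module L W]
    (σ : Representation L (Matrix.GeneralLinearGroup (Fin 2) L) W) : Representation L (K p) W :=
  σ.comp (incl p L)

/-! ### The representations `V_{l,k} = det^l ⊗ Sym^{k-1} L²` -/

section Sym

variable {L : Type u} [Field L]

/-- The linear form `g • x_j = ∑ i, g i j • x_i`: writing `x = x_0`, `y = x_1` and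
`g = (a b; c d)`, these are `g • x = a x + c y` and `g • y = b x + d y`. -/
noncomputable def linForm (g : Matrix (Fin 2) (Fin 2) L) (j : Fin 2) : MvPolynomial (Fin 2) L :=
  ∑ i, MvPolynomial.C (g i j) * MvPolynomial.X i

/-- The substitution `P(x, y) ↦ P(a x + c y, b x + d y)` attached to `g = (a b; c d)`. -/
noncomputable def subst (g : Matrix (Fin 2) (Fin 2) L) :
    MvPolynomial (Fin 2) L →ₐ[L] MvPolynomial (Fin 2) L :=
  MvPolynomial.aeval (linForm g)

theorem subst_one : subst (1 : Matrix (Fin 2) (Fin 2) L) = AlgHom.id L _ := by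
  apply MvPolynomial.algHom_ext
  intro j
  fin_cases j <;> simp [subst, linForm]

theorem subst_mul (g h : Matrix (Fin 2) (Fin 2) L) :
    subst (g * h) = (subst g).comp (subst h) := by
  apply MvPolynomial.algHom_ext
  intro j
  simp only [subst, linForm, AlgHom.comp_apply, MvPolynomial.aeval_X, Fin.sum_univ_two, map_add,
    map_mul, MvPolynomial.algHom_C, MvPolynomial.algebraMap_eq, Matrix.mul_apply]
  ring

theorem linForm_isHomogeneous (g : Matrix (Fin 2) (Fin 2) L) (j : Fin 2) :
    (linForm g j).IsHomogeneous 1 :=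
  MvPolynomial.IsHomogeneous.sum _ _ _ fun i _ => MvPolynomial.isHomogeneous_C_mul_X (g i j) i

theorem subst_mem (g : Matrix (Fin 2) (Fin 2) L) (n : ℕ) (P : MvPolynomial (Fin 2) L)
    (hP : P ∈ MvPolynomial.homogeneousSubmodule (Fin 2) L n) :
    (subst g).toLinearMap P ∈ MvPolynomial.homogeneousSubmodule (Fin 2) L n := by
  rw [MvPolynomial.mem_homogeneousSubmodule] at hP ⊢
  have h := hP.aeval (linForm g) (linForm_isHomogeneous g)
  rwa [one_mul] at h

variable (L) in
/-- The space of homogeneous polynomials of degree `k - 1` in two variables over `L`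
(`k` is a positive integer). -/
abbrev VSpace (k : ℕ+) : Type u :=
  MvPolynomial.homogeneousSubmodule (Fin 2) L ((k : ℕ) - 1)

variable (L) in
/-- The representation `det^l ⊗ Sym^{k-1} L²` of `GL₂(L)` on homogeneous polynomials of degree
`k - 1`: the matrix `g = (a b; c d)` acts by `P(x, y) ↦ (ad - bc)^l P(ax + cy, bx + dy)`. -/
noncomputable def V (l : ℤ) (k : ℕ+) :
    Representation L (Matrix.GeneralLinearGroup (Fin 2) L) (VSpace L k) where
  toFun g := ((Matrix.GeneralLinearGroup.det g ^ l : Lˣ) : L) •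
    (subst (g : Matrix (Fin 2) (Fin 2) L)).toLinearMap.restrict (subst_mem _ _)
  map_one' := by
    ext P
    simp [LinearMap.restrict_apply, subst_one]
  map_mul' g h := by
    ext P
    simp [LinearMap.restrict_apply, subst_mul, mul_zpow, mul_left_comm, mul_assoc]

/-! ### Algebraic representations of `GL₂` -/

/-- A representation of `GL₂(L)` is algebraic if its matrix coefficients `g ↦ ℓ(g w)` are regular
functions on `GL₂`, that is, of the form `P(g) / det(g)^n` with `P` a polynomial in the four matrix
entries. (The field `L` is infinite, so this is the same as a representation of the algebraic group
`GL₂` over `L`.) -/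
def IsAlgebraicRep {W : Type u} [AddCommGroup W] [Module L W]
    (σ : Representation L (Matrix.GeneralLinearGroup (Fin 2) L) W) : Prop :=
  ∀ (ℓ : Module.Dual L W) (w : W), ∃ (P : MvPolynomial (Fin 2 × Fin 2) L) (n : ℕ),
    ∀ g : Matrix.GeneralLinearGroup (Fin 2) L,
      (g : Matrix (Fin 2) (Fin 2) L).det ^ n * ℓ (σ g w) =
        MvPolynomial.eval (fun ij => (g : Matrix (Fin 2) (Fin 2) L) ij.1 ij.2) P

end Sym

/-! ### Banach space representations of `K` -/

section Banach

variable {p : ℕ} [Fact p.Prime] {L : Type u} [NontriviallyNormedField L] [NormedAlgebra ℚ_[p] L]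

/-- `ρ` is a unitary Banach space representation of `K` on `E`: the action `K × E → E` is
continuous and preserves the norm. -/
structure IsUnitaryRep {E : Type*} [NormedAddCommGroup E] [NormedSpace L E]
    (ρ : Representation L (K p) E) : Prop where
  continuous_action : Continuous fun x : K p × E => ρ x.1 x.2
  norm_map : ∀ (g : K p) (v : E), ‖ρ g v‖ = ‖v‖

variable (p L) in
/-- The representation of `K` on `C(K, L)` by right translations, `(h f)(g) = f(g h)`. Here
`C(K, L)` carries the compact-open topology; as `K` is compact, this is the topology of the
supremum norm. -/
noncomputable def rightReg : Representation L (K p) C(K p, L) where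
  toFun h :=
    { toFun := fun f => f.comp ⟨fun g => g * h, continuous_mul_const h⟩
      map_add' := fun _ _ => rfl
      map_smul' := fun _ _ => rfl }
  map_one' := by
    ext f g
    simp
  map_mul' h h' := by
    ext f g
    simp [mul_assoc]

variable (p L) in
/-- The representation `C(K, L)^{⊕ r}` of `K`. -/
noncomputable def rightRegPow (r : ℕ) : Representation L (K p) (Fin r → C(K p, L)) where
  toFun h := LinearMap.pi fun i => (rightReg p L h).comp (LinearMap.proj i)
  map_one' := by
    ext f i g
    simp
  map_mul' h h' := by
    ext f i g
    simp

/-- `E` is isomorphic, by a `K`-equivariant topological isomorphism, to a direct summand of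
`C(K, L)^{⊕ r}`: to a closed `K`-stable subspace that has a closed `K`-stable complement. -/
def IsSummandOfRegular {E : Type*} [NormedAddCommGroup E] [NormedSpace L E]
    (ρ : Representation L (K p) E) (r : ℕ) : Prop :=
  ∃ M N : Subrepresentation (rightRegPow p L r),
    IsClosed (M.toSubmodule : Set (Fin r → C(K p, L))) ∧
    IsClosed (N.toSubmodule : Set (Fin r → C(K p, L))) ∧
    IsCompl M.toSubmodule N.toSubmodule ∧
    ∃ e : E ≃L[L] M.toSubmodule, ∀ (g : K p) (v : E), e (ρ g v) = M.toRepresentation g (e v)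

/-- A vector `v` of `E` is `K`-algebraic if it lies in the image of a `K`-equivariant linear map
`W → E` for some finite dimensional algebraic representation `W` of `GL₂` over `L`. -/
def IsAlgebraicVector {E : Type*} [AddCommGroup E] [Module L E] (ρ : Representation L (K p) E)
    (v : E) : Prop :=
  ∃ (W : Type u) (_ : AddCommGroup W) (_ : Module L W) (_ : FiniteDimensional L W)
    (σ : Representation L (Matrix.GeneralLinearGroup (Fin 2) L) W),
    IsAlgebraicRep σ ∧ ∃ (f : (resK p σ).IntertwiningMap ρ) (w : W), f w = v

/-- `Hom_K(V_{l,k}, E)`, for `i = (l, k)`. -/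
abbrev HomV {E : Type*} [AddCommGroup E] [Module L E] (ρ : Representation L (K p) E)
    (i : ℤ × ℕ+) : Type _ :=
  (resK p (V L i.1 i.2)).IntertwiningMap ρ

/-- The evaluation map `⨁_{(l,k)} Hom_K(V_{l,k}, E) ⊗ V_{l,k} → E`, `φ ⊗ v ↦ φ(v)`. -/
noncomputable def evalMap {E : Type*} [AddCommGroup E] [Module L E]
    (ρ : Representation L (K p) E) :
    (⨁ i : ℤ × ℕ+, HomV ρ i ⊗[L] VSpace L i.2) →ₗ[L] E :=
  DirectSum.toModule L (ℤ × ℕ+) E fun i =>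
    TensorProduct.lift (Representation.IntertwiningMap.toLinearMapl (resK p (V L i.1 i.2)) ρ)

end Banach

end KAlg

/-!
The theorem rests on a Peter–Weyl statement for `GL₂` and on Frobenius reciprocity for `C(K, L)`.

*Regular functions are matrix coefficients.* Write `a, b, c, d` for the matrix entries. The matrix
coefficients of `V_{l,k}` are spanned by `det^l` times the coefficients of `(a + c X)^i (b + d X)^m`
with `i + m = k - 1`. A Clebsch–Gordan computation (`mul_coeff_mem`) shows that the span `coeffSpan`
of all of these is stable under multiplication by the four entries; being stable under `det^{±1}`
too, it contains every regular function `P / det^n` (`mem_coeffSpan_of_regular`).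

*Density.* Mahler's theorem makes every continuous function of one matrix entry a uniform limit of
polynomials. Hence the closed algebra generated by the entries contains the indicator functions of
the residue classes modulo `p^n`, and so is all of `C(K, L)` (`topologicalClosure_polyFunctions`).

*Frobenius reciprocity.* An equivariant map `φ : V → C(K, L)` is `v ↦ (g ↦ ℓ(g v))` with
`ℓ(v) = φ(v)(1)`. So `Hom_K(V_{l,k}, C(K, L)^r)` has finite dimension, every matrix coefficient lies
in the image of the evaluation map, and every algebraic vector of `C(K, L)^r` has regular functions
as components. By the first step the image of the evaluation map for `C(K, L)^r` then contains all
algebraic vectors and is dense. All this passes to `E` through an equivariant continuous retraction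
`C(K, L)^r → E` (`IsSummandOfRegular.exists_retraction`), so that complete reducibility of algebraic
representations is not needed.

*Injectivity* holds for any representation of `K` (`injective_evalMap`). Given a relation
`∑ φ_{i,j}(x^j y^{n_i - j}) = 0`, apply `(1 b; 0 1) (1 0; c 1)` and compare coefficients of `b^n`,
where `n` is the largest of the degrees `n_i`: what remains is
`∑_{n_i = n} (∑_j c^j φ_{i,j})(x^n) = 0`. The terms are eigenvectors of `diag(1, 1 + p)` with
distinct eigenvalues `(1 + p)^l`, so each of them vanishes. Since `x^n` generates `V_{l,n+1}`,
`∑_j c^j φ_{i,j} = 0` for all natural numbers `c`, and all `φ_{i,j}` with `n_i = n` are zero.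
-/

namespace KAlg

universe u


/-! ### Products of coefficients with the entries of a matrix -/

section Coefficients

open Polynomial

variable {L : Type*} [Field L] [CharZero L] {R : Type*} [CommRing R] [Algebra L R]

theorem natCast_mul_mem_iff (S : Submodule L R) {n : ℕ} (hn : n ≠ 0) {x : R} :
    (n : R) * x ∈ S ↔ x ∈ S := by
  have h : (n : R) * x = (n : L) • x := by rw [Algebra.smul_def, map_natCast]
  rw [h, S.smul_mem_iff (Nat.cast_ne_zero.mpr hn)]

/-- A form of the Clebsch–Gordan decomposition `Symⁿ ⊗ Sym¹ = Symⁿ⁺¹ ⊕ det ⊗ Symⁿ⁻¹`. Put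
`p = a + c X` and `q = b + d X`; the coefficients of `pⁱ qᵏ` are matrix coefficients of
`Symⁱ⁺ᵏ` at the matrix `(a b; c d)`, whose determinant is `D = a d - b c`. With `f = pⁱ⁺¹ qᵏ` one has
`f' = (i + k + 1) c pⁱ qᵏ + k D pⁱ qᵏ⁻¹` and
`(i + k + 1) a pⁱ qᵏ = (i + k + 1) f - X f' + k D X pⁱ qᵏ⁻¹`, so that in characteristic zero the
products with `a` and `c` are combinations of coefficients for `Symⁱ⁺ᵏ⁺¹` and of `D` times
coefficients for `Symⁱ⁺ᵏ⁻¹`. -/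
theorem mul_coeff_mem (S : Submodule L R) (a b c d t : R)
    (h₁ : ∀ i k j : ℕ, t * ((C a + C c * X) ^ i * (C b + C d * X) ^ k).coeff j ∈ S)
    (h₂ : ∀ i k j : ℕ,
      t * (a * d - b * c) * ((C a + C c * X) ^ i * (C b + C d * X) ^ k).coeff j ∈ S)
    (i k j : ℕ) :
    t * a * ((C a + C c * X) ^ i * (C b + C d * X) ^ k).coeff j ∈ S ∧
    t * c * ((C a + C c * X) ^ i * (C b + C d * X) ^ k).coeff j ∈ S := by
  have hder : derivative ((C a + C c * X) ^ (i + 1) * (C b + C d * X) ^ k) =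
      ((i + 1 + k : ℕ) : R[X]) * (C c * ((C a + C c * X) ^ i * (C b + C d * X) ^ k)) +
      (k : R[X]) * (C (a * d - b * c) * ((C a + C c * X) ^ i * (C b + C d * X) ^ (k - 1))) := by
    rcases k with _ | k
    · simp [derivative_pow]
      ring
    · simp [derivative_pow]
      ring
  have hid : ((i + 1 + k : ℕ) : R[X]) * (C a * ((C a + C c * X) ^ i * (C b + C d * X) ^ k)) =
      ((i + 1 + k : ℕ) : R[X]) * ((C a + C c * X) ^ (i + 1) * (C b + C d * X) ^ k) -
      X * derivative ((C a + C c * X) ^ (i + 1) * (C b + C d * X) ^ k) +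
      (k : R[X]) * (X * (C (a * d - b * c) *
        ((C a + C c * X) ^ i * (C b + C d * X) ^ (k - 1)))) := by
    rw [hder]
    ring
  have hn : i + 1 + k ≠ 0 := by omega
  constructor
  · rw [← natCast_mul_mem_iff S hn]
    have h := congrArg (fun f => t * f.coeff j) hid
    simp only [coeff_add, coeff_sub, coeff_natCast_mul, coeff_C_mul, mul_add, mul_sub] at h
    have e : ((i + 1 + k : ℕ) : R) *
        (t * a * ((C a + C c * X) ^ i * (C b + C d * X) ^ k).coeff j) =
        t * (((i + 1 + k : ℕ) : R) * (a * ((C a + C c * X) ^ i * (C b + C d * X) ^ k).coeff j)) := by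
      ring
    rw [e, h]
    refine S.add_mem (S.sub_mem ?_ ?_) ?_
    · rw [mul_left_comm, natCast_mul_mem_iff S hn]
      exact h₁ _ _ _
    · rcases j with _ | j
      · simp
      · rw [coeff_X_mul, coeff_derivative, ← mul_assoc, mul_comm]
        rw [show ((j : R) + 1) = ((j + 1 : ℕ) : R) by push_cast; rfl,
          natCast_mul_mem_iff S (by omega)]
        exact h₁ _ _ _
    · rcases k with _ | k
      · simp
      · rw [mul_left_comm, natCast_mul_mem_iff S (by omega)]
        rcases j with _ | j
        · simp
        · rw [coeff_X_mul, coeff_C_mul, ← mul_assoc]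
          exact h₂ _ _ _
  · rw [← natCast_mul_mem_iff S hn]
    have h := congrArg (fun f => t * f.coeff j) hder
    simp only [coeff_add, coeff_natCast_mul, coeff_C_mul, mul_add, coeff_derivative] at h
    have e : ((i + 1 + k : ℕ) : R) *
        (t * c * ((C a + C c * X) ^ i * (C b + C d * X) ^ k).coeff j) =
        ((j + 1 : ℕ) : R) *
          (t * ((C a + C c * X) ^ (i + 1) * (C b + C d * X) ^ k).coeff (j + 1)) -
        (k : R) * (t * (a * d - b * c) *
          ((C a + C c * X) ^ i * (C b + C d * X) ^ (k - 1)).coeff j) := by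
      push_cast at h ⊢
      linear_combination -h
    rw [e]
    refine S.sub_mem ((natCast_mul_mem_iff S (by omega)).mpr (h₁ _ _ _)) ?_
    rcases k with _ | k
    · simp
    · exact (natCast_mul_mem_iff S (by omega)).mpr (h₂ _ _ _)

end Coefficients

/-! ### The representations `V_{l,k}` -/

section Sym

variable {L : Type u} [Field L]

/-- The monomial `x^i y^m` as a vector of `V_{l,k}`, where `i + m = k - 1`. -/
noncomputable def mono (k : ℕ+) (i m : ℕ) (h : i + m = (k : ℕ) - 1) : VSpace L k :=
  ⟨MvPolynomial.X 0 ^ i * MvPolynomial.X 1 ^ m, by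
    rw [MvPolynomial.mem_homogeneousSubmodule, ← h]
    simpa using ((MvPolynomial.isHomogeneous_X L (0 : Fin 2)).pow i).mul
      ((MvPolynomial.isHomogeneous_X L (1 : Fin 2)).pow m)⟩

theorem span_mono (k : ℕ+) :
    Submodule.span L {v : VSpace L k | ∃ i m h, v = mono k i m h} = ⊤ := by
  rw [← Submodule.map_injective_of_injective
    (Submodule.injective_subtype (MvPolynomial.homogeneousSubmodule (Fin 2) L ((k : ℕ) - 1)))
    |>.eq_iff]
  apply le_antisymm
  · exact Submodule.map_mono le_top
  rintro _ ⟨⟨P, hP⟩, -, rfl⟩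
  rw [Submodule.map_span]
  change P ∈ _
  rw [P.as_sum]
  refine Submodule.sum_mem _ fun s hs => ?_
  have hdeg : s 0 + s 1 = (k : ℕ) - 1 := by
    have := hP (MvPolynomial.mem_support_iff.mp hs)
    rw [← this, Finsupp.weight_apply, Finsupp.sum_fintype _ _ (by simp)]
    simp [Fin.sum_univ_two]
  rw [MvPolynomial.monomial_eq, ← MvPolynomial.smul_eq_C_mul]
  refine Submodule.smul_mem _ _ (Submodule.subset_span ⟨mono k (s 0) (s 1) hdeg, ⟨_, _, _, rfl⟩, ?_⟩)
  rw [Finsupp.prod_fintype _ _ (by simp)]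
  simp [mono, Fin.prod_univ_two]

theorem VSpace.induction {k : ℕ+} {C : VSpace L k → Prop}
    (h0 : C 0) (hadd : ∀ v w, C v → C w → C (v + w)) (hsmul : ∀ (a : L) v, C v → C (a • v))
    (hmono : ∀ i m h, C (mono k i m h)) (v : VSpace L k) : C v := by
  have hv : v ∈ Submodule.span L {v : VSpace L k | ∃ i m h, v = mono k i m h} := by
    rw [span_mono]; trivial
  induction hv using Submodule.span_induction with
  | mem x hx => obtain ⟨i, m, h, rfl⟩ := hx; exact hmono i m h
  | zero => exact h0
  | add x y _ _ hx hy => exact hadd x y hx hy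
  | smul a x _ hx => exact hsmul a x hx

instance (k : ℕ+) : FiniteDimensional L (VSpace L k) :=
  Module.Finite.iff_fg.mpr (MvPolynomial.homogeneousSubmodule_fg (Fin 2) L _)

theorem coe_V_apply (l : ℤ) (k : ℕ+) (g : Matrix.GeneralLinearGroup (Fin 2) L) (v : VSpace L k) :
    (V L l k g v : MvPolynomial (Fin 2) L) =
      ((Matrix.GeneralLinearGroup.det g ^ l : Lˣ) : L) •
        subst (g : Matrix (Fin 2) (Fin 2) L) (v : MvPolynomial (Fin 2) L) := rfl

/-- A matrix coefficient of the substitution action of `GL₂` on polynomials is a polynomial in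
the matrix entries. -/
theorem exists_eval_eq_subst (P : MvPolynomial (Fin 2) L) :
    ∀ ℓ : Module.Dual L (MvPolynomial (Fin 2) L), ∃ Q : MvPolynomial (Fin 2 × Fin 2) L,
      ∀ g : Matrix (Fin 2) (Fin 2) L,
        ℓ (subst g P) = MvPolynomial.eval (fun ij => g ij.1 ij.2) Q := by
  induction P using MvPolynomial.induction_on with
  | C a => exact fun ℓ => ⟨MvPolynomial.C (ℓ (MvPolynomial.C a)), fun g => by
      simp [subst, MvPolynomial.algHom_C]⟩
  | add P P' hP hP' =>
    intro ℓ
    obtain ⟨Q, hQ⟩ := hP ℓ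
    obtain ⟨Q', hQ'⟩ := hP' ℓ
    exact ⟨Q + Q', fun g => by simp [hQ, hQ']⟩
  | mul_X P j hP =>
    intro ℓ
    choose Q hQ using fun i : Fin 2 => hP (ℓ ∘ₗ LinearMap.mulRight L (MvPolynomial.X i))
    refine ⟨∑ i, MvPolynomial.X (i, j) * Q i, fun g => ?_⟩
    simp only [map_sum, map_mul, MvPolynomial.eval_X, ← hQ]
    simp only [subst, MvPolynomial.aeval_X, linForm, Finset.mul_sum, map_sum, LinearMap.comp_apply,
      LinearMap.mulRight_apply]
    refine Finset.sum_congr rfl fun i _ => ?_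
    rw [mul_left_comm, ← MvPolynomial.smul_eq_C_mul, map_smul, smul_eq_mul]

theorem exists_eval_eq_dual_V (l : ℤ) (k : ℕ+) (ℓ : Module.Dual L (VSpace L k)) (v : VSpace L k) :
    ∃ Q : MvPolynomial (Fin 2 × Fin 2) L, ∀ g : Matrix.GeneralLinearGroup (Fin 2) L,
      ℓ (V L l k g v) = ((Matrix.GeneralLinearGroup.det g ^ l : Lˣ) : L) *
        MvPolynomial.eval (fun ij => (g : Matrix (Fin 2) (Fin 2) L) ij.1 ij.2) Q := by
  obtain ⟨ℓ', hℓ'⟩ := LinearMap.exists_extend ℓ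
  obtain ⟨Q, hQ⟩ := exists_eval_eq_subst (v : MvPolynomial (Fin 2) L) ℓ'
  refine ⟨Q, fun g => ?_⟩
  rw [← hQ, ← hℓ', LinearMap.comp_apply, Submodule.subtype_apply, coe_V_apply, map_smul,
    smul_eq_mul]

/-- The determinant as a polynomial in the matrix entries. -/
noncomputable def detPoly (L : Type*) [Field L] : MvPolynomial (Fin 2 × Fin 2) L :=
  .X (0, 0) * .X (1, 1) - .X (0, 1) * .X (1, 0)

theorem eval_detPoly (g : Matrix (Fin 2) (Fin 2) L) :
    MvPolynomial.eval (fun ij => g ij.1 ij.2) (detPoly L) = g.det := by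
  simp [detPoly, Matrix.det_fin_two]

theorem isAlgebraicRep_V (l : ℤ) (k : ℕ+) : IsAlgebraicRep (V L l k) := by
  intro ℓ v
  obtain ⟨Q, hQ⟩ := exists_eval_eq_dual_V l k ℓ v
  -- `det^|l|` clears the possible denominator in `det^l`
  refine ⟨detPoly L ^ (l.natAbs + l).toNat * Q, l.natAbs, fun g => ?_⟩
  rw [hQ, map_mul, map_pow, eval_detPoly, ← mul_assoc]
  congr 1
  have h : ((g : Matrix (Fin 2) (Fin 2) L).det) = ((Matrix.GeneralLinearGroup.det g : Lˣ) : L) := rfl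
  have h' : (l.natAbs : ℤ) + l = ((l.natAbs + l).toNat : ℤ) := by omega
  rw [h, ← Units.val_pow_eq_pow_val, ← Units.val_pow_eq_pow_val, ← Units.val_mul,
    ← zpow_natCast, ← zpow_natCast, ← zpow_add, ← h']

theorem isAlgebraicRep_prod {W W' : Type u} [AddCommGroup W] [Module L W] [AddCommGroup W']
    [Module L W'] {σ : Representation L (Matrix.GeneralLinearGroup (Fin 2) L) W}
    {σ' : Representation L (Matrix.GeneralLinearGroup (Fin 2) L) W'}
    (h : IsAlgebraicRep σ) (h' : IsAlgebraicRep σ') : IsAlgebraicRep (σ.prod σ') := by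
  intro ℓ w
  obtain ⟨P, n, hP⟩ := h (ℓ ∘ₗ LinearMap.inl L W W') w.1
  obtain ⟨P', n', hP'⟩ := h' (ℓ ∘ₗ LinearMap.inr L W W') w.2
  refine ⟨detPoly L ^ n' * P + detPoly L ^ n * P', n + n', fun g => ?_⟩
  have e : ℓ (σ.prod σ' g w) = (ℓ ∘ₗ LinearMap.inl L W W') (σ g w.1) +
      (ℓ ∘ₗ LinearMap.inr L W W') (σ' g w.2) := by
    simp [← map_add]
  rw [e, map_add, map_mul, map_mul, map_pow, map_pow, eval_detPoly, ← hP, ← hP']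
  ring

end Sym

/-! ### Regular functions and matrix coefficients -/

section RegularFunctions

variable (p : ℕ) [Fact p.Prime] (L : Type u) [NontriviallyNormedField L] [NormedAlgebra ℚ_[p] L]

theorem continuous_intToField : Continuous (intToField p L) :=
  (continuous_algebraMap ℚ_[p] L).comp continuous_subtype_val

/-- The matrix entry `g ↦ g i j` as a continuous function on `K`. -/
noncomputable def entry (ij : Fin 2 × Fin 2) : C(K p, L) where
  toFun g := intToField p L (g ij.1 ij.2)
  continuous_toFun := (continuous_intToField p L).comp
    ((Units.continuous_val (M := Matrix (Fin 2) (Fin 2) ℤ_[p])).matrix_elem ij.1 ij.2)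

theorem incl_apply (g : K p) (i j : Fin 2) :
    (incl p L g : Matrix (Fin 2) (Fin 2) L) i j = entry p L (i, j) g := rfl

theorem aeval_entry_apply (P : MvPolynomial (Fin 2 × Fin 2) L) (g : K p) :
    MvPolynomial.aeval (entry p L) P g =
      MvPolynomial.eval (fun ij => (incl p L g : Matrix (Fin 2) (Fin 2) L) ij.1 ij.2) P := by
  have h : (MvPolynomial.aeval (entry p L) P) g =
      (ContinuousMap.evalAlgHom L L g) (MvPolynomial.aeval (entry p L) P) := rfl
  rw [h, ← AlgHom.comp_apply, MvPolynomial.comp_aeval, MvPolynomial.aeval_eq_eval]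
  rfl

/-- The determinant as a unit of the ring of continuous functions on `K`. -/
noncomputable def detUnit : C(K p, L)ˣ where
  val := MvPolynomial.aeval (entry p L) (detPoly L)
  inv := (MvPolynomial.aeval (entry p L) (detPoly L)).comp ⟨fun g => g⁻¹, continuous_inv⟩
  val_inv := by
    ext g
    simp only [ContinuousMap.mul_apply, ContinuousMap.comp_apply, ContinuousMap.coe_mk,
      aeval_entry_apply, eval_detPoly, ← Matrix.det_mul, ContinuousMap.one_apply]
    rw [← Units.val_mul, ← map_mul, mul_inv_cancel, map_one, Units.val_one, Matrix.det_one]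
  inv_val := by
    ext g
    simp only [ContinuousMap.mul_apply, ContinuousMap.comp_apply, ContinuousMap.coe_mk,
      aeval_entry_apply, eval_detPoly, ← Matrix.det_mul, ContinuousMap.one_apply]
    rw [← Units.val_mul, ← map_mul, inv_mul_cancel, map_one, Units.val_one, Matrix.det_one]

theorem detUnit_zpow_apply (l : ℤ) (g : K p) :
    ((detUnit p L ^ l : C(K p, L)ˣ) : C(K p, L)) g =
      ((Matrix.GeneralLinearGroup.det (incl p L g) ^ l : Lˣ) : L) := by
  have h : Units.map (ContinuousMap.evalAlgHom L L g : C(K p, L) →* L) (detUnit p L) =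
      Matrix.GeneralLinearGroup.det (incl p L g) :=
    Units.ext ((aeval_entry_apply p L _ g).trans (eval_detPoly _))
  rw [← h, ← map_zpow]
  rfl

variable {p L}

/-- The matrix coefficient `g ↦ ℓ(g v)` of `V_{l,k}` as a continuous function on `K`. -/
noncomputable def matrixCoeff (l : ℤ) (k : ℕ+) (ℓ : Module.Dual L (VSpace L k)) (v : VSpace L k) :
    C(K p, L) where
  toFun g := ℓ (V L l k (incl p L g) v)
  continuous_toFun := by
    obtain ⟨Q, hQ⟩ := exists_eval_eq_dual_V l k ℓ v
    convert (((detUnit p L ^ l : C(K p, L)ˣ) : C(K p, L)) *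
      MvPolynomial.aeval (entry p L) Q).continuous using 1
    ext g
    rw [hQ, ContinuousMap.mul_apply, detUnit_zpow_apply, aeval_entry_apply]

open Polynomial in
/-- The linear form on `V_{l,k}` that reads off the coefficient of `y^j`, via `x = 1`. -/
noncomputable def coeffForm (k : ℕ+) (j : ℕ) : Module.Dual L (VSpace L k) :=
  Polynomial.lcoeff L j ∘ₗ
    (MvPolynomial.aeval ![(1 : L[X]), (X : L[X])]).toLinearMap ∘ₗ Submodule.subtype _

variable (p L) in
open Polynomial in
/-- The coefficient of `X^j` in `(a + c X)^i (b + d X)^m`, where `a, b, c, d` are the entries of the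
matrix, as a function on `K`. -/
noncomputable def entryCoeff (i m j : ℕ) : C(K p, L) :=
  ((C (entry p L (0, 0)) + C (entry p L (1, 0)) * X) ^ i *
    (C (entry p L (0, 1)) + C (entry p L (1, 1)) * X) ^ m).coeff j

open Polynomial in
theorem matrixCoeff_mono (l : ℤ) (k : ℕ+) (i m : ℕ) (h : i + m = (k : ℕ) - 1) (j : ℕ) :
    (matrixCoeff l k (coeffForm k j) (mono k i m h) : C(K p, L)) =
      ((detUnit p L ^ l : C(K p, L)ˣ) : C(K p, L)) *
        entryCoeff p L i m j := by
  ext g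
  rw [ContinuousMap.mul_apply, detUnit_zpow_apply]
  have h1 : ∀ F : C(K p, L)[X], F.coeff j g =
      (F.map (ContinuousMap.evalAlgHom L L g : C(K p, L) →+* L)).coeff j := fun F => by
    rw [coeff_map]; rfl
  rw [entryCoeff, h1]
  change coeffForm k j (V L l k (incl p L g) (mono k i m h)) = _
  simp only [coeffForm, LinearMap.comp_apply, Submodule.subtype_apply, coe_V_apply, map_smul,
    smul_eq_mul, AlgHom.toLinearMap_apply, lcoeff_apply]
  congr 2
  simp only [mono, map_mul, map_pow, subst, MvPolynomial.aeval_X, linForm, Fin.sum_univ_two,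
    map_add, MvPolynomial.algHom_C, Polynomial.map_mul, Polynomial.map_pow, Polynomial.map_add,
    Polynomial.map_C, Polynomial.map_X]
  simp [incl_apply, Polynomial.algebraMap_eq]

variable (p L) in
/-- The span in `C(K, L)` of the matrix coefficients of all the `V_{l,k}` at monomials and at the
linear forms reading off one coefficient (see `matrixCoeff_mono`). -/
noncomputable def coeffSpan : Submodule L C(K p, L) :=
  Submodule.span L {f | ∃ (l : ℤ) (i m j : ℕ),
    f = ((detUnit p L ^ l : C(K p, L)ˣ) : C(K p, L)) * entryCoeff p L i m j}

theorem detUnit_zpow_mul_mem {f : C(K p, L)} (hf : f ∈ coeffSpan p L) (n : ℤ) :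
    ((detUnit p L ^ n : C(K p, L)ˣ) : C(K p, L)) * f ∈ coeffSpan p L := by
  induction hf using Submodule.span_induction with
  | mem f hf =>
    obtain ⟨l, i, m, j, rfl⟩ := hf
    rw [← mul_assoc, ← Units.val_mul, ← zpow_add]
    exact Submodule.subset_span ⟨_, _, _, _, rfl⟩
  | zero => simp
  | add f f' _ _ hf hf' => rw [mul_add]; exact add_mem hf hf'
  | smul a f _ hf => rw [mul_smul_comm]; exact Submodule.smul_mem _ _ hf

theorem coe_detUnit : (detUnit p L : C(K p, L)) =
    entry p L (0, 0) * entry p L (1, 1) - entry p L (0, 1) * entry p L (1, 0) := by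
  simp [detUnit, detPoly]

/-- The span of the matrix coefficients is stable under multiplication by the matrix entries:
the first column is covered by `mul_coeff_mem`, the second by exchanging the columns. -/
theorem entry_mul_mem [CharZero L] {f : C(K p, L)} (hf : f ∈ coeffSpan p L) (ij : Fin 2 × Fin 2) :
    entry p L ij * f ∈ coeffSpan p L := by
  induction hf using Submodule.span_induction with
  | mem f hf =>
    obtain ⟨l, i, m, j, rfl⟩ := hf
    rw [← mul_assoc, mul_comm (entry p L ij)]
    have h₁ : ∀ i m j : ℕ, ((detUnit p L ^ l : C(K p, L)ˣ) : C(K p, L)) * entryCoeff p L i m j ∈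
        coeffSpan p L := fun i m j => Submodule.subset_span ⟨_, _, _, _, rfl⟩
    have h₂ : ∀ i m j : ℕ, ((detUnit p L ^ l : C(K p, L)ˣ) : C(K p, L)) *
        (detUnit p L : C(K p, L)) * entryCoeff p L i m j ∈ coeffSpan p L := fun i m j =>
      Submodule.subset_span ⟨l + 1, _, _, _, by rw [zpow_add_one, Units.val_mul]⟩
    have hcol₀ := mul_coeff_mem (coeffSpan p L) (entry p L (0, 0)) (entry p L (0, 1))
      (entry p L (1, 0)) (entry p L (1, 1)) _ h₁ (by rw [← coe_detUnit]; exact h₂) i m j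
    -- exchanging the two columns of the matrix changes the sign of the determinant
    have hcol₁ := mul_coeff_mem (coeffSpan p L) (entry p L (0, 1)) (entry p L (0, 0))
      (entry p L (1, 1)) (entry p L (1, 0)) ((detUnit p L ^ l : C(K p, L)ˣ) : C(K p, L))
      (fun i m j => by rw [mul_comm (_ ^ i)]; exact h₁ m i j)
      (fun i m j => by
        rw [mul_comm (_ ^ i), ← neg_sub, mul_comm (entry p L (0, 0)), mul_comm (entry p L (0, 1)),
          mul_comm (entry p L (1, 1)), mul_neg, neg_mul,
          mul_comm (entry p L (1, 0)), ← coe_detUnit]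
        exact neg_mem (h₂ m i j)) m i j
    rw [mul_comm (_ ^ m)] at hcol₁
    obtain ⟨r, s⟩ := ij
    fin_cases r <;> fin_cases s
    exacts [hcol₀.1, hcol₁.1, hcol₀.2, hcol₁.2]
  | zero => simp
  | add f f' _ _ hf hf' => rw [mul_add]; exact add_mem hf hf'
  | smul a f _ hf => rw [mul_smul_comm]; exact Submodule.smul_mem _ _ hf

theorem aeval_entry_mem [CharZero L] (P : MvPolynomial (Fin 2 × Fin 2) L) :
    MvPolynomial.aeval (entry p L) P ∈ coeffSpan p L := by
  induction P using MvPolynomial.induction_on with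
  | C a =>
    rw [MvPolynomial.algHom_C, Algebra.algebraMap_eq_smul_one]
    exact Submodule.smul_mem _ _ (Submodule.subset_span ⟨0, 0, 0, 0, by simp [entryCoeff]⟩)
  | add P Q hP hQ => rw [map_add]; exact add_mem hP hQ
  | mul_X P ij hP =>
    rw [map_mul, MvPolynomial.aeval_X, mul_comm]
    exact entry_mul_mem hP ij

/-- Every regular function on `GL₂`, restricted to `K`, is a combination of matrix coefficients of
the `V_{l,k}`. -/
theorem mem_coeffSpan_of_regular [CharZero L] (f : C(K p, L)) (n : ℕ)
    (P : MvPolynomial (Fin 2 × Fin 2) L)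
    (h : ∀ g : K p, (incl p L g : Matrix (Fin 2) (Fin 2) L).det ^ n * f g =
      MvPolynomial.eval (fun ij => (incl p L g : Matrix (Fin 2) (Fin 2) L) ij.1 ij.2) P) :
    f ∈ coeffSpan p L := by
  have hf : ((detUnit p L ^ (n : ℤ) : C(K p, L)ˣ) : C(K p, L)) * f =
      MvPolynomial.aeval (entry p L) P := by
    ext g
    rw [ContinuousMap.mul_apply, detUnit_zpow_apply, aeval_entry_apply, ← h, zpow_natCast,
      Units.val_pow_eq_pow_val]
    rfl
  have := detUnit_zpow_mul_mem (aeval_entry_mem (p := p) P) (-n)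
  rwa [← hf, ← mul_assoc, ← Units.val_mul, ← zpow_add, neg_add_cancel, zpow_zero, Units.val_one,
    one_mul] at this

end RegularFunctions

/-! ### Density of the regular functions -/

section Density

theorem charZero (p : ℕ) [Fact p.Prime] (L : Type*) [NontriviallyNormedField L]
    [NormedAlgebra ℚ_[p] L] : CharZero L :=
  charZero_of_injective_algebraMap (algebraMap ℚ_[p] L).injective

variable {p : ℕ} [Fact p.Prime]

instance : CompactSpace (K p) :=
  haveI : CompactSpace (Matrix (Fin 2) (Fin 2) ℤ_[p]) :=
    inferInstanceAs (CompactSpace (Fin 2 → Fin 2 → ℤ_[p]))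
  inferInstanceAs (CompactSpace (Matrix (Fin 2) (Fin 2) ℤ_[p])ˣ)

theorem isLocallyConstant_toZModPow (n : ℕ) :
    IsLocallyConstant (PadicInt.toZModPow n : ℤ_[p] → ZMod (p ^ n)) := by
  rw [IsLocallyConstant.iff_eventually_eq]
  intro x
  have hp : (0 : ℝ) < (p : ℝ) ^ (-n : ℤ) :=
    zpow_pos (by exact_mod_cast (Fact.out : p.Prime).pos) _
  filter_upwards [Metric.ball_mem_nhds x hp] with y hy
  rw [← sub_eq_zero, ← map_sub, ← RingHom.mem_ker, PadicInt.ker_toZModPow,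
    ← PadicInt.norm_le_pow_iff_mem_span_pow]
  rw [Metric.mem_ball, dist_eq_norm] at hy
  exact hy.le

/-- The indicator function of a residue class modulo `p ^ n`. -/
noncomputable def residueIndicator (n : ℕ) (q : ZMod (p ^ n)) : C(ℤ_[p], ℤ_[p]) :=
  open Classical in
  ⟨fun x => if PadicInt.toZModPow n x = q then 1 else 0,
    ((isLocallyConstant_toZModPow n).comp fun y => if y = q then 1 else 0).continuous⟩

/-- A continuous function on `K` is nearly constant on the residue classes modulo `p ^ n`, for `n`
large. -/
theorem exists_residue_uniform {F : Type*} [NormedAddCommGroup F] (f : C(K p, F)) {ε : ℝ} (hε : 0 < ε) :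
    ∃ n : ℕ, ∀ g g' : K p,
      (∀ i j, PadicInt.toZModPow n (g i j) = PadicInt.toZModPow n (g' i j)) →
        ‖f g - f g'‖ < ε := by
  by_contra! H
  -- the closed sets of bad pairs are nested, and a common point would be on the diagonal
  let t : ℕ → Set (K p × K p) := fun n =>
    {x | (∀ i j, PadicInt.toZModPow n (x.1 i j) = PadicInt.toZModPow n (x.2 i j)) ∧
      ε ≤ ‖f x.1 - f x.2‖}
  have hentry : ∀ i j, Continuous fun g : K p => g i j := fun i j =>
    (Units.continuous_val (M := Matrix (Fin 2) (Fin 2) ℤ_[p])).matrix_elem i j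
  have hclosed : ∀ n, IsClosed (t n) := fun n => by
    have ht : t n = (⋂ i, ⋂ j, {x : K p × K p |
        PadicInt.toZModPow n (x.1 i j) = PadicInt.toZModPow n (x.2 i j)}) ∩
        {x | ε ≤ ‖f x.1 - f x.2‖} := by
      ext x
      simp [t]
    rw [ht]
    refine IsClosed.inter (isClosed_iInter fun i => isClosed_iInter fun j => ?_)
      (isClosed_le continuous_const
        ((f.continuous.comp continuous_fst).sub (f.continuous.comp continuous_snd)).norm)
    let : TopologicalSpace (ZMod (p ^ n)) := ⊥
    have : DiscreteTopology (ZMod (p ^ n)) := ⟨rfl⟩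
    have hc := (isLocallyConstant_toZModPow (p := p) n).continuous
    exact isClosed_eq (hc.comp ((hentry i j).comp continuous_fst))
      (hc.comp ((hentry i j).comp continuous_snd))
  obtain ⟨x, hx⟩ := IsCompact.nonempty_iInter_of_sequence_nonempty_isCompact_isClosed t
    (fun n x hx => ⟨fun i j => by
      have := congrArg (ZMod.castHom (pow_dvd_pow p n.le_succ) (ZMod (p ^ n))) (hx.1 i j)
      simpa only [← RingHom.comp_apply, PadicInt.zmod_cast_comp_toZModPow _ _ n.le_succ]
        using this, hx.2⟩)
    (fun n => by
      obtain ⟨g, g', h, h'⟩ := H n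
      exact ⟨(g, g'), h, h'⟩)
    (hclosed 0).isCompact hclosed
  rw [Set.mem_iInter] at hx
  have hxx : x.1 = x.2 := by
    refine Units.ext (Matrix.ext fun i j => ?_)
    exact (PadicInt.ext_of_toZModPow.mp fun n => (hx n).1 i j)
  have := (hx 0).2
  rw [hxx, sub_self, norm_zero] at this
  exact absurd hε this.not_gt

variable (L : Type u) [NontriviallyNormedField L] [NormedAlgebra ℚ_[p] L]

variable (p) in
/-- The algebra of polynomial functions in the matrix entries. -/
noncomputable def polyFunctions : Subalgebra L C(K p, L) :=
  (MvPolynomial.aeval (entry p L) : MvPolynomial (Fin 2 × Fin 2) L →ₐ[L] C(K p, L)).range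

/-- Composition of a continuous function `ℤ_p → ℤ_p` with a matrix entry. -/
noncomputable def compEntry (ij : Fin 2 × Fin 2) : C(ℤ_[p], ℤ_[p]) →+ C(K p, L) where
  toFun h := ⟨fun g => intToField p L (h (g ij.1 ij.2)),
    (continuous_intToField p L).comp (h.continuous.comp
      ((Units.continuous_val (M := Matrix (Fin 2) (Fin 2) ℤ_[p])).matrix_elem ij.1 ij.2))⟩
  map_zero' := by ext; simp
  map_add' h h' := by ext; simp

theorem continuous_compEntry (ij : Fin 2 × Fin 2) :
    Continuous (compEntry L ij : C(ℤ_[p], ℤ_[p]) → C(K p, L)) :=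
  (ContinuousMap.continuous_postcomp ⟨intToField p L, continuous_intToField p L⟩).comp
    (ContinuousMap.continuous_precomp ⟨fun g : K p => g ij.1 ij.2,
      (Units.continuous_val (M := Matrix (Fin 2) (Fin 2) ℤ_[p])).matrix_elem ij.1 ij.2⟩)

theorem compEntry_mahlerTerm_mem (ij : Fin 2 × Fin 2) (a : ℤ_[p]) (n : ℕ) :
    compEntry L ij (PadicInt.mahlerTerm a n) ∈ polyFunctions p L := by
  have := charZero p L
  -- the `n`-th Mahler function is `X (X - 1) ⋯ (X - n + 1) / n!`
  have h : compEntry L ij (PadicInt.mahlerTerm a n) =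
      ((n.factorial : L)⁻¹ * intToField p L a) •
        Polynomial.aeval (entry p L ij) (descPochhammer L n) := by
    ext g
    have h1 : Polynomial.aeval (entry p L ij) (descPochhammer L n) g =
        intToField p L ((descPochhammer ℤ_[p] n).eval (g ij.1 ij.2)) := by
      change ContinuousMap.evalAlgHom L L g (Polynomial.aeval (entry p L ij) (descPochhammer L n))
        = _
      rw [← Polynomial.aeval_algHom_apply, ← descPochhammer_map (intToField p L),
        Polynomial.aeval_def, Polynomial.eval₂_map, ← Polynomial.eval₂_hom]
      rfl
    have h2 : (descPochhammer ℤ_[p] n).eval (g ij.1 ij.2) =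
        n.factorial * Ring.choose (g ij.1 ij.2) n := by
      rw [← nsmul_eq_mul, ← Ring.descPochhammer_eq_factorial_smul_choose,
        ← descPochhammer_map (Int.castRingHom ℤ_[p]), Polynomial.eval_map,
        ← Polynomial.eval₂_smulOneHom_eq_smeval]
      congr 1
      exact RingHom.ext_int _ _
    rw [ContinuousMap.smul_apply, h1, h2, map_mul, map_natCast, smul_eq_mul]
    have h3 : (compEntry L ij (PadicInt.mahlerTerm a n)) g =
        intToField p L (Ring.choose (g ij.1 ij.2) n) * intToField p L a := by
      change intToField p L (PadicInt.mahlerTerm a n (g ij.1 ij.2)) = _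
      rw [PadicInt.mahlerTerm_apply, mahler_apply, smul_eq_mul, map_mul]
    rw [h3]
    have : (n.factorial : L) ≠ 0 := Nat.cast_ne_zero.mpr n.factorial_ne_zero
    field_simp
  rw [h]
  refine (polyFunctions p L).smul_mem ((AlgHom.mem_range _).mpr
    ⟨Polynomial.aeval (MvPolynomial.X ij) (descPochhammer L n), ?_⟩) _
  rw [← Polynomial.aeval_algHom_apply, MvPolynomial.aeval_X]

/-- By Mahler's theorem, a continuous function of one matrix entry is a uniform limit of polynomial
functions. -/
theorem compEntry_mem (ij : Fin 2 × Fin 2) (h : C(ℤ_[p], ℤ_[p])) :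
    compEntry L ij h ∈ (polyFunctions p L).topologicalClosure := by
  have hs := (PadicInt.hasSum_mahler h).map (compEntry L ij) (continuous_compEntry L ij)
  refine mem_closure_of_tendsto hs (Filter.Eventually.of_forall fun s => ?_)
  exact sum_mem fun n _ => compEntry_mahlerTerm_mem L ij _ n

variable (p) in
/-- Polynomials in the matrix entries are dense in `C(K, L)`. -/
theorem topologicalClosure_polyFunctions : (polyFunctions p L).topologicalClosure = ⊤ := by
  classical
  rw [eq_top_iff]
  rintro f -
  rw [← SetLike.mem_coe, ← (polyFunctions p L).isClosed_topologicalClosure.closure_eq,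
    Metric.mem_closure_iff]
  intro ε hε
  obtain ⟨n, hn⟩ := exists_residue_uniform f (half_pos hε)
  have : NeZero (p ^ n) := ⟨pow_ne_zero _ (Fact.out : p.Prime).ne_zero⟩
  let red : K p → Fin 2 × Fin 2 → ZMod (p ^ n) := fun g ij => PadicInt.toZModPow n (g ij.1 ij.2)
  -- a representative of each residue class that meets `K`
  let s : (Fin 2 × Fin 2 → ZMod (p ^ n)) → K p := Function.invFun red
  let χ : (Fin 2 × Fin 2 → ZMod (p ^ n)) → C(K p, L) := fun q =>
    ∏ ij, compEntry L ij (residueIndicator n (q ij))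
  have hχ : ∀ q g, χ q g = if red g = q then 1 else 0 := by
    intro q g
    rw [ContinuousMap.prod_apply]
    split_ifs with h
    · refine Finset.prod_eq_one fun ij _ => ?_
      have : PadicInt.toZModPow n (g ij.1 ij.2) = q ij := congrFun h ij
      simp [compEntry, residueIndicator, this]
    · obtain ⟨ij, hij⟩ := Function.ne_iff.mp h
      refine Finset.prod_eq_zero (Finset.mem_univ ij) ?_
      have : PadicInt.toZModPow n (g ij.1 ij.2) ≠ q ij := hij
      simp [compEntry, residueIndicator, this]
  refine ⟨∑ q, f (s q) • χ q, sum_mem fun q _ => Subalgebra.smul_mem _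
    (prod_mem fun ij _ => compEntry_mem L ij _) _, ?_⟩
  refine lt_of_le_of_lt ?_ (half_lt_self hε)
  rw [ContinuousMap.dist_le (half_pos hε).le]
  intro g
  have hval : (∑ q, f (s q) • χ q) g = f (s (red g)) := by
    simp [ContinuousMap.sum_apply, hχ]
  rw [hval, dist_eq_norm]
  have hs : red (s (red g)) = red g := Function.invFun_eq ⟨g, rfl⟩
  exact (hn _ _ fun i j => (congrFun hs (i, j)).symm).le

variable (p) in
theorem dense_coeffSpan : Dense (coeffSpan p L : Set C(K p, L)) := by
  have := charZero p L
  have h : (polyFunctions p L : Set C(K p, L)) ⊆ coeffSpan p L := by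
    rintro _ ⟨P, rfl⟩
    exact aeval_entry_mem P
  refine Dense.mono h ?_
  rw [dense_iff_closure_eq, ← Subalgebra.topologicalClosure_coe, topologicalClosure_polyFunctions]
  rfl

end Density

/-! ### The evaluation map and Frobenius reciprocity -/

section Evaluation

variable {p : ℕ} [Fact p.Prime] {L : Type u} [NontriviallyNormedField L] [NormedAlgebra ℚ_[p] L]
variable {E : Type*} [AddCommGroup E] [Module L E] {ρ : Representation L (K p) E}
variable {E' : Type*} [AddCommGroup E'] [Module L E'] {ρ' : Representation L (K p) E'}

theorem evalMap_lof_tmul (i : ℤ × ℕ+) (φ : HomV ρ i) (v : VSpace L i.2) :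
    evalMap ρ (DirectSum.lof L (ℤ × ℕ+) (fun i => HomV ρ i ⊗[L] VSpace L i.2) i (φ ⊗ₜ v)) = φ v := by
  rw [evalMap, DirectSum.toModule_lof, TensorProduct.lift.tmul]
  rfl

theorem range_evalMap (ρ : Representation L (K p) E) : LinearMap.range (evalMap ρ) =
    Submodule.span L {x | ∃ (i : ℤ × ℕ+) (φ : HomV ρ i) (v : VSpace L i.2), x = φ v} := by
  apply le_antisymm
  · rintro _ ⟨t, rfl⟩
    induction t using DirectSum.induction_on with
    | zero => simp
    | of i t =>
      induction t with
      | zero => simp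
      | tmul φ v =>
        exact Submodule.subset_span ⟨i, φ, v, evalMap_lof_tmul i φ v⟩
      | add s t hs ht => rw [map_add, map_add]; exact add_mem hs ht
    | add s t hs ht => rw [map_add]; exact add_mem hs ht
  · rw [Submodule.span_le]
    rintro _ ⟨i, φ, v, rfl⟩
    exact ⟨_, evalMap_lof_tmul i φ v⟩

theorem map_mem_range_evalMap (T : ρ.IntertwiningMap ρ') {x : E}
    (hx : x ∈ LinearMap.range (evalMap ρ)) : T x ∈ LinearMap.range (evalMap ρ') := by
  rw [range_evalMap] at hx ⊢
  induction hx using Submodule.span_induction with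
  | mem x hx =>
    obtain ⟨i, φ, v, rfl⟩ := hx
    exact Submodule.subset_span ⟨i, T.comp φ, v, rfl⟩
  | zero => rw [map_zero]; exact zero_mem _
  | add x y _ _ hx hy => rw [map_add]; exact add_mem hx hy
  | smul a x _ hx => rw [map_smul]; exact Submodule.smul_mem _ _ hx

theorem isAlgebraicVector_of_mem_range {x : E} (hx : x ∈ LinearMap.range (evalMap ρ)) :
    IsAlgebraicVector ρ x := by
  rw [range_evalMap] at hx
  induction hx using Submodule.span_induction with
  | mem x hx =>
    obtain ⟨i, φ, v, rfl⟩ := hx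
    exact ⟨VSpace L i.2, inferInstance, inferInstance, inferInstance, V L i.1 i.2,
      isAlgebraicRep_V _ _, φ, v, rfl⟩
  | zero =>
    exact ⟨VSpace L 1, inferInstance, inferInstance, inferInstance, V L 0 1,
      isAlgebraicRep_V _ _, 0, 0, rfl⟩
  | add x y _ _ hx hy =>
    obtain ⟨W, _, _, _, σ, hσ, f, w, rfl⟩ := hx
    obtain ⟨W', _, _, _, σ', hσ', f', w', rfl⟩ := hy
    refine ⟨W × W', inferInstance, inferInstance, inferInstance, σ.prod σ',
      isAlgebraicRep_prod hσ hσ', ⟨f.toLinearMap.coprod f'.toLinearMap, fun g => ?_⟩, (w, w'), rfl⟩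
    refine LinearMap.ext fun v => ?_
    change f (resK p σ g v.1) + f' (resK p σ' g v.2) = ρ g (f v.1 + f' v.2)
    rw [f.isIntertwining, f'.isIntertwining, map_add]
  | smul a x _ hx =>
    obtain ⟨W, _, _, _, σ, hσ, f, w, rfl⟩ := hx
    exact ⟨W, inferInstance, inferInstance, inferInstance, σ, hσ, f, a • w, map_smul f a w⟩

variable (p) in
/-- The equivariant map `V_{l,k} → C(K, L)^{⊕ r}` attached by Frobenius reciprocity to a linear
form `ℓ` on `V_{l,k}` and an index of a summand: `v ↦ (g ↦ ℓ(g v))`. -/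
noncomputable def coeffHom (r : ℕ) (i : Fin r) (l : ℤ) (k : ℕ+) (ℓ : Module.Dual L (VSpace L k)) :
    HomV (rightRegPow p L r) (l, k) where
  toFun v := Pi.single i (matrixCoeff l k ℓ v)
  map_add' v w := by
    rw [← Pi.single_add]
    congr 1
    ext g
    simp [matrixCoeff]
  map_smul' a v := by
    rw [RingHom.id_apply, ← Pi.single_smul]
    congr 1
    ext g
    simp [matrixCoeff]
  isIntertwining' h := by
    ext v j g
    by_cases hj : j = i
    · subst hj
      simp [rightRegPow, rightReg, matrixCoeff, resK]
    · simp [rightRegPow, rightReg, Pi.single_eq_of_ne hj]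

theorem mem_range_evalMap_rightRegPow {r : ℕ} {F : Fin r → C(K p, L)}
    (hF : ∀ i, F i ∈ coeffSpan p L) : F ∈ LinearMap.range (evalMap (rightRegPow p L r)) := by
  have h : ∀ (i : Fin r) (f : C(K p, L)), f ∈ coeffSpan p L →
      LinearMap.single L (fun _ : Fin r => C(K p, L)) i f ∈
        LinearMap.range (evalMap (rightRegPow p L r)) := by
    intro i f hf
    induction hf using Submodule.span_induction with
    | mem f hf =>
      obtain ⟨l, a, b, j, rfl⟩ := hf
      rw [range_evalMap]
      refine Submodule.subset_span ⟨(l, ⟨a + b + 1, Nat.succ_pos _⟩),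
        coeffHom p r i l _ (coeffForm _ j), mono _ a b rfl, ?_⟩
      rw [← matrixCoeff_mono l ⟨a + b + 1, Nat.succ_pos _⟩ a b rfl j]
      rfl
    | zero => simp
    | add f f' _ _ hf hf' => rw [map_add]; exact add_mem hf hf'
    | smul a f _ hf => rw [map_smul]; exact Submodule.smul_mem _ _ hf
  rw [← Finset.univ_sum_single F]
  exact sum_mem fun i _ => h i _ (hF i)

theorem dense_range_evalMap_rightRegPow (r : ℕ) :
    Dense (LinearMap.range (evalMap (rightRegPow p L r)) : Set (Fin r → C(K p, L))) :=
  (dense_pi Set.univ fun _ _ => dense_coeffSpan p L).mono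
    fun F (hF : ∀ i ∈ Set.univ, F i ∈ coeffSpan p L) =>
      mem_range_evalMap_rightRegPow fun i => hF i (Set.mem_univ i)

/-- An equivariant map from an algebraic representation to `C(K, L)^{⊕ r}` takes its values in the
tuples of regular functions, hence in the image of the evaluation map. -/
theorem mem_range_evalMap_of_isAlgebraicVector {r : ℕ} {F : Fin r → C(K p, L)}
    (hF : IsAlgebraicVector (rightRegPow p L r) F) :
    F ∈ LinearMap.range (evalMap (rightRegPow p L r)) := by
  have := charZero p L
  obtain ⟨W, _, _, _, σ, hσ, f, w, rfl⟩ := hF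
  refine mem_range_evalMap_rightRegPow fun i => ?_
  obtain ⟨P, n, hP⟩ := hσ ((ContinuousMap.evalAlgHom L L (1 : K p)).toLinearMap ∘ₗ
    LinearMap.proj i ∘ₗ f.toLinearMap) w
  refine mem_coeffSpan_of_regular _ n P fun g => ?_
  rw [← hP]
  congr 1
  have h := f.isIntertwining _ _ g w
  change f w i g = f (σ (incl p L g) w) i 1
  change f (σ (incl p L g) w) = _ at h
  rw [h]
  change f w i g = f w i (1 * g)
  rw [one_mul]

theorem IsAlgebraicVector.map (T : ρ.IntertwiningMap ρ') {x : E} (hx : IsAlgebraicVector ρ x) :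
    IsAlgebraicVector ρ' (T x) := by
  obtain ⟨W, _, _, _, σ, hσ, f, w, rfl⟩ := hx
  exact ⟨W, inferInstance, inferInstance, inferInstance, σ, hσ, T.comp f, w, rfl⟩

/-- By Frobenius reciprocity, evaluation at `1` embeds `Hom_K(V_{l,k}, C(K, L)^{⊕ r})` into `r` copies
of the dual of `V_{l,k}`. -/
theorem finiteDimensional_homV_of_injective {r : ℕ} (T : ρ.IntertwiningMap (rightRegPow p L r))
    (hT : Function.Injective T) (i : ℤ × ℕ+) : FiniteDimensional L (HomV ρ i) := by
  -- `φ ↦ (v ↦ T(φ v)_j(1))_j`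
  let A : HomV ρ i →ₗ[L] (Fin r → Module.Dual L (VSpace L i.2)) :=
    { toFun := fun φ j => (ContinuousMap.evalAlgHom L L (1 : K p)).toLinearMap ∘ₗ
        LinearMap.proj j ∘ₗ T.toLinearMap ∘ₗ φ.toLinearMap
      map_add' := fun φ ψ => by ext; simp
      map_smul' := fun a φ => by ext; simp }
  refine FiniteDimensional.of_injective A ((injective_iff_map_eq_zero A).mpr fun φ hφ => ?_)
  apply DFunLike.ext
  intro v
  apply hT
  rw [Representation.IntertwiningMap.coe_zero, Pi.zero_apply, map_zero]
  ext j g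
  have h := LinearMap.congr_fun (congrFun hφ j) (resK p (V L i.1 i.2) g v)
  change T (φ (resK p (V L i.1 i.2) g v)) j 1 = 0 at h
  rw [φ.isIntertwining, T.isIntertwining] at h
  change T (φ v) j (1 * g) = 0 at h
  rwa [one_mul] at h

end Evaluation

/-! ### Direct summands of `C(K, L)^{⊕ r}` -/

section Summand

variable {p : ℕ} [Fact p.Prime] {L : Type u} [NontriviallyNormedField L]
  [CompleteSpace L]
variable {E : Type*} [NormedAddCommGroup E] [NormedSpace L E] {ρ : Representation L (K p) E}

/-- A direct summand of `C(K, L)^{⊕ r}` is an equivariant continuous retract of it. -/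
theorem IsSummandOfRegular.exists_retraction {r : ℕ} (h : IsSummandOfRegular ρ r) :
    ∃ (S : ρ.IntertwiningMap (rightRegPow p L r)) (T : (rightRegPow p L r).IntertwiningMap ρ),
      Continuous T ∧ ∀ v, T (S v) = v := by
  obtain ⟨M, N, hM, hN, hMN, e, he⟩ := h
  let π := M.toSubmodule.projectionOntoL N.toSubmodule (Submodule.IsCompl.isTopCompl_of_isClosed hMN hM hN)
  have hπ : ∀ g F, π (rightRegPow p L r g F) = M.toRepresentation g (π F) := by
    intro g F
    simp only [π, Submodule.coe_projectionOntoL]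
    obtain ⟨m, n, rfl, -⟩ := Submodule.existsUnique_add_of_isCompl hMN F
    rw [map_add, map_add, map_add, Submodule.projectionOnto_apply_left,
      Submodule.projectionOnto_apply_right hMN n, add_zero]
    have h1 := Submodule.projectionOnto_apply_left hMN (M.toRepresentation g m)
    have h2 := Submodule.projectionOnto_apply_right hMN (N.toRepresentation g n)
    change Submodule.projectionOnto _ _ hMN (rightRegPow p L r g m) = _ at h1
    change Submodule.projectionOnto _ _ hMN (rightRegPow p L r g n) = _ at h2
    rw [h1, h2, add_zero]
  refine ⟨⟨M.toSubmodule.subtype ∘ₗ e.toLinearMap, fun g => ?_⟩,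
    ⟨e.symm.toLinearMap ∘ₗ π.toLinearMap, fun g => ?_⟩, e.symm.continuous.comp π.continuous,
    fun v => ?_⟩
  · ext1 v
    exact congrArg Subtype.val (he g v)
  · refine LinearMap.ext fun F => ?_
    change e.symm (π (rightRegPow p L r g F)) = ρ g (e.symm (π F))
    rw [hπ, ContinuousLinearEquiv.symm_apply_eq, he, ContinuousLinearEquiv.apply_symm_apply]
  · change e.symm (π (e v : Fin r → C(K p, L))) = v
    simp only [π, Submodule.coe_projectionOntoL,
      Submodule.projectionOnto_apply_left, ContinuousLinearEquiv.symm_apply_apply]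

end Summand

/-! ### Linear independence of equivariant maps on distinct `V_{l,k}` -/

section Independence

theorem eq_zero_of_sum_natCast_pow_smul_eq_zero {L : Type*} [Field L] [CharZero L] {E : Type*}
    [AddCommGroup E] [Module L E] {N : ℕ} {e : Fin N → E}
    (h : ∀ b : ℕ, ∑ r : Fin N, (b : L) ^ (r : ℕ) • e r = 0) (r : Fin N) : e r = 0 := by
  rw [← Module.forall_dual_apply_eq_zero_iff L]
  intro f
  let q : Polynomial L := ∑ r : Fin N, Polynomial.monomial (r : ℕ) (f (e r))
  have hq : q = 0 := by
    refine Polynomial.eq_zero_of_infinite_isRoot q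
      ((Set.infinite_range_of_injective (Nat.cast_injective (R := L))).mono ?_)
    rintro _ ⟨b, rfl⟩
    have := congrArg f (h b)
    simpa [q, Polynomial.eval_finsetSum, mul_comm] using this
  have hr := congrArg (fun q => Polynomial.coeff q r) hq
  simpa [q, Polynomial.finsetSum_coeff, Polynomial.coeff_monomial, Fin.val_inj] using hr

theorem eq_zero_of_sum_eigenvectors_eq_zero {L : Type*} [Field L] {E : Type*}
    [AddCommGroup E] [Module L E] {ι : Type*} (f : Module.End L E) (s : Finset ι) (μ : ι → L)
    (hμ : Set.InjOn μ s) (e : ι → E) (he : ∀ i ∈ s, f (e i) = μ i • e i)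
    (h : ∑ i ∈ s, e i = 0) : ∀ i ∈ s, e i = 0 := by
  classical
  induction s using Finset.induction_on generalizing e with
  | empty => simp
  | insert a s ha ih =>
    have hs : ∀ i ∈ s, (μ i - μ a) • e i = 0 := by
      refine ih (hμ.mono (by simp)) (fun i => (μ i - μ a) • e i) (fun i hi => ?_) ?_
      · rw [map_smul, he i (Finset.mem_insert_of_mem hi), smul_comm]
      · have h1 := congrArg f h
        rw [map_zero, map_sum, Finset.sum_congr rfl he, Finset.sum_insert ha] at h1
        rw [Finset.sum_insert ha] at h
        simp only [sub_smul, Finset.sum_sub_distrib, ← Finset.smul_sum]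
        rw [← eq_neg_iff_add_eq_zero] at h
        rw [h, smul_neg, neg_add_eq_zero] at h1
        rw [h1, sub_self]
    have hs' : ∀ i ∈ s, e i = 0 := fun i hi =>
      (smul_eq_zero.mp (hs i hi)).resolve_left (sub_ne_zero.mpr fun hia =>
        ha (hμ (by simp [hi]) (by simp) hia ▸ hi))
    rw [Finset.sum_insert ha, Finset.sum_eq_zero hs', add_zero] at h
    intro i hi
    rcases Finset.mem_insert.mp hi with rfl | hi
    exacts [h, hs' i hi]

variable (p : ℕ) [Fact p.Prime]

/-- The lower unipotent matrix `(1 0; c 1)` in `K`. -/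
noncomputable def lowerUnipotent (c : ℕ) : K p :=
  Matrix.GeneralLinearGroup.mk'' !![1, 0; (c : ℤ_[p]), 1] (by simp)

/-- The upper unipotent matrix `(1 b; 0 1)` in `K`. -/
noncomputable def upperUnipotent (b : ℕ) : K p :=
  Matrix.GeneralLinearGroup.mk'' !![1, (b : ℤ_[p]); 0, 1] (by simp)

/-- The diagonal matrix with entries `1` and `1 + p` in `K`. -/
noncomputable def torusElement : K p :=
  Matrix.GeneralLinearGroup.mk'' !![1, 0; 0, ((p + 1 : ℕ) : ℤ_[p])] (by
    rw [Matrix.det_fin_two_of, PadicInt.isUnit_iff]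
    simp only [one_mul, mul_zero, sub_zero]
    rw [PadicInt.norm_natCast_eq_one_iff]
    simp)

theorem zpow_natCast_succ_injective (L : Type*) [Field L] [CharZero L] :
    Function.Injective fun l : ℤ => ((p + 1 : ℕ) : L) ^ l := by
  intro l l' h
  have hp : 0 < p := (Fact.out : p.Prime).pos
  have h' : (((p + 1 : ℕ) : ℚ) : L) ^ l = (((p + 1 : ℕ) : ℚ) : L) ^ l' := by
    rw [Rat.cast_natCast]; exact h
  rw [← Rat.cast_zpow, ← Rat.cast_zpow, Rat.cast_inj] at h'
  exact zpow_right_injective₀ (by positivity)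
    (by rw [Nat.cast_ne_one]; omega) h'

variable (L : Type u) [NontriviallyNormedField L] [NormedAlgebra ℚ_[p] L]

theorem coe_incl_lowerUnipotent (c : ℕ) :
    (incl p L (lowerUnipotent p c) : Matrix (Fin 2) (Fin 2) L) = !![1, 0; (c : L), 1] := by
  ext i j
  change intToField p L (!![1, 0; (c : ℤ_[p]), 1] i j) = _
  fin_cases i <;> fin_cases j <;> simp

theorem coe_incl_upperUnipotent (b : ℕ) :
    (incl p L (upperUnipotent p b) : Matrix (Fin 2) (Fin 2) L) = !![1, (b : L); 0, 1] := by
  ext i j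
  change intToField p L (!![1, (b : ℤ_[p]); 0, 1] i j) = _
  fin_cases i <;> fin_cases j <;> simp

theorem coe_incl_torusElement :
    (incl p L (torusElement p) : Matrix (Fin 2) (Fin 2) L) = !![1, 0; 0, ((p + 1 : ℕ) : L)] := by
  ext i j
  change intToField p L (!![1, 0; 0, ((p + 1 : ℕ) : ℤ_[p])] i j) = _
  fin_cases i <;> fin_cases j <;> simp [-Nat.cast_add]

variable {p L}

theorem coe_V_apply_of_det_eq_one (l : ℤ) (k : ℕ+) {g : Matrix.GeneralLinearGroup (Fin 2) L}
    (hg : (g : Matrix (Fin 2) (Fin 2) L).det = 1) (v : VSpace L k) :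
    (V L l k g v : MvPolynomial (Fin 2) L) =
      subst (g : Matrix (Fin 2) (Fin 2) L) (v : MvPolynomial (Fin 2) L) := by
  have h : Matrix.GeneralLinearGroup.det g = 1 := Units.ext hg
  rw [coe_V_apply, h, one_zpow, Units.val_one, one_smul]

variable (L) in
/-- The highest weight vector `x^{k-1}` of `V_{l,k}`. -/
noncomputable def highest (k : ℕ+) : VSpace L k := mono k ((k : ℕ) - 1) 0 rfl

/-- The linear form `P ↦ P(0, 1)` on `V_{l,k}`. -/
noncomputable def evalY (k : ℕ+) : Module.Dual L (VSpace L k) :=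
  (MvPolynomial.aeval ![(0 : L), 1]).toLinearMap ∘ₗ Submodule.subtype _

theorem evalY_mono (k : ℕ+) (i m : ℕ) (h : i + m = (k : ℕ) - 1) :
    evalY k (mono k i m h : VSpace L k) = if i = 0 then 1 else 0 := by
  simp [evalY, mono, zero_pow_eq]

theorem evalY_lowerUnipotent_mono (l : ℤ) (k : ℕ+) (i m : ℕ) (h : i + m = (k : ℕ) - 1) (c : ℕ) :
    evalY k (V L l k (incl p L (lowerUnipotent p c)) (mono k i m h)) = (c : L) ^ i := by
  rw [evalY, LinearMap.comp_apply, Submodule.subtype_apply,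
    coe_V_apply_of_det_eq_one l k (by simp [coe_incl_lowerUnipotent]), coe_incl_lowerUnipotent]
  simp [mono, subst, linForm]

theorem torusElement_highest (l : ℤ) (k : ℕ+) :
    V L l k (incl p L (torusElement p)) (highest L k) =
      ((p + 1 : ℕ) : L) ^ l • highest L k := by
  have hdet : ((Matrix.GeneralLinearGroup.det (incl p L (torusElement p)) : Lˣ) : L) =
      ((p + 1 : ℕ) : L) := by
    change (incl p L (torusElement p) : Matrix (Fin 2) (Fin 2) L).det = _
    rw [coe_incl_torusElement, Matrix.det_fin_two_of]
    simp
  ext1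
  rw [coe_V_apply, Units.val_zpow_eq_zpow_val, hdet, coe_incl_torusElement, Submodule.coe_smul]
  congr 1
  simp [highest, mono, subst, linForm]

theorem lowerUnipotent_highest (l : ℤ) (k : ℕ+) (c : ℕ) :
    V L l k (incl p L (lowerUnipotent p c)) (highest L k) =
      ∑ r : Fin k, (c : L) ^ (r : ℕ) • ((((k : ℕ) - 1).choose r : L) •
        mono k ((k : ℕ) - 1 - r) r (by omega)) := by
  ext1
  rw [coe_V_apply_of_det_eq_one l k (by simp [coe_incl_lowerUnipotent]), coe_incl_lowerUnipotent]
  have hk : (k : ℕ) = (k : ℕ) - 1 + 1 := by have := k.pos; omega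
  have h1 : subst !![1, 0; (c : L), 1] (highest L k : MvPolynomial (Fin 2) L) =
      (MvPolynomial.C (c : L) * MvPolynomial.X 1 + MvPolynomial.X 0) ^ ((k : ℕ) - 1) := by
    simp [highest, mono, subst, linForm, add_comm]
  rw [h1, add_pow, ← hk, Finset.sum_range, AddSubmonoidClass.coe_finsetSum]
  refine Finset.sum_congr rfl fun r _ => ?_
  simp only [mono, Submodule.coe_smul, MvPolynomial.smul_eq_C_mul, map_pow, map_natCast]
  ring

/-- The expansion of `P(x, b x + y)` in powers of `b`: it has degree at most `k - 1`, and the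
coefficient of `b^{k-1}` is `P(0, 1) x^{k-1}`. -/
theorem exists_upperUnipotent_expansion (l : ℤ) (k : ℕ+) (v : VSpace L k) :
    ∃ w : ℕ → VSpace L k, (∀ r, (k : ℕ) ≤ r → w r = 0) ∧ w ((k : ℕ) - 1) = evalY k v • highest L k ∧
      ∀ (b N : ℕ), (k : ℕ) ≤ N →
        V L l k (incl p L (upperUnipotent p b)) v = ∑ r : Fin N, (b : L) ^ (r : ℕ) • w r := by
  induction v using VSpace.induction with
  | h0 => exact ⟨0, by simp, by simp, by simp⟩
  | hadd v v' hv hv' =>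
    obtain ⟨w, h1, h2, h3⟩ := hv
    obtain ⟨w', h1', h2', h3'⟩ := hv'
    refine ⟨w + w', fun r hr => by simp [h1 r hr, h1' r hr], by simp [h2, h2', add_smul],
      fun b N hN => ?_⟩
    simp [map_add, h3 b N hN, h3' b N hN, Finset.sum_add_distrib]
  | hsmul a v hv =>
    obtain ⟨w, h1, h2, h3⟩ := hv
    refine ⟨a • w, fun r hr => by simp [h1 r hr], by simp [h2, mul_smul], fun b N hN => ?_⟩
    rw [map_smul, h3 b N hN, Finset.smul_sum]
    exact Finset.sum_congr rfl fun r _ => smul_comm _ _ _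
  | hmono i m h =>
    have hk := k.pos
    refine ⟨fun r => if hr : r ≤ m then (m.choose r : L) • mono k (i + r) (m - r) (by omega) else 0,
      fun r hr => dif_neg (by omega), ?_, fun b N hN => ?_⟩
    · rw [evalY_mono]
      rcases Nat.eq_zero_or_pos i with rfl | hi
      · obtain rfl : m = (k : ℕ) - 1 := by omega
        simp [highest]
      · simp only
        rw [dif_neg (by omega), if_neg (by omega), zero_smul]
    · rw [← Finset.sum_range fun r => (b : L) ^ r •
        (if hr : r ≤ m then (m.choose r : L) • mono k (i + r) (m - r) (by omega) else
          (0 : VSpace L k))]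
      rw [← Finset.sum_subset (Finset.range_mono (show m + 1 ≤ N by omega)) fun r _ hr => by
        rw [dif_neg (by simpa using hr), smul_zero]]
      ext1
      rw [coe_V_apply_of_det_eq_one l k (by simp [coe_incl_upperUnipotent]),
        coe_incl_upperUnipotent]
      have h1 : subst !![1, (b : L); 0, 1] (mono (L := L) k i m h : MvPolynomial (Fin 2) L) =
          MvPolynomial.X 0 ^ i *
            (MvPolynomial.C (b : L) * MvPolynomial.X 0 + MvPolynomial.X 1) ^ m := by
        simp [mono, subst, linForm]
      rw [h1, add_pow, AddSubmonoidClass.coe_finsetSum, Finset.mul_sum]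
      refine Finset.sum_congr rfl fun r hr => ?_
      rw [dif_pos (by simpa [Nat.lt_succ_iff] using hr)]
      simp only [mono, Submodule.coe_smul, MvPolynomial.smul_eq_C_mul, map_pow, map_natCast]
      ring

variable {E : Type*} [AddCommGroup E] [Module L E] {ρ : Representation L (K p) E}

/-- An equivariant map on `V_{l,k}` is determined by its value at the highest weight vector, because
the coefficients of `c^r` in `(x + c y)^{k-1}` are nonzero multiples of all the monomials. -/
theorem homV_eq_zero_of_apply_highest {i : ℤ × ℕ+} (φ : HomV ρ i)
    (hφ : φ (highest L i.2) = 0) : φ = 0 := by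
  have := charZero p L
  have h : ∀ r : Fin i.2, φ ((((i.2 : ℕ) - 1).choose r : L) •
      mono i.2 ((i.2 : ℕ) - 1 - r) r (by omega)) = 0 := by
    refine eq_zero_of_sum_natCast_pow_smul_eq_zero (L := L) fun c => ?_
    have h1 := φ.isIntertwining _ _ (lowerUnipotent p c) (highest L i.2)
    rw [hφ, map_zero] at h1
    change φ (V L i.1 i.2 (incl p L (lowerUnipotent p c)) (highest L i.2)) = 0 at h1
    rw [lowerUnipotent_highest, map_sum] at h1
    simpa only [map_smul] using h1
  apply DFunLike.ext
  intro v
  induction v using VSpace.induction with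
  | h0 => simp
  | hadd v w hv hw => rw [map_add, hv, hw, map_add]
  | hsmul a v hv => rw [map_smul, hv, map_smul]
  | hmono a m ham =>
    have hi := i.2.pos
    have h1 := h ⟨m, by omega⟩
    obtain rfl : a = (i.2 : ℕ) - 1 - m := by omega
    rw [map_smul, smul_eq_zero] at h1
    exact h1.resolve_left (Nat.cast_ne_zero.mpr (Nat.choose_pos (by simp; omega)).ne')

theorem exists_eq_sum_tmul_mono {k : ℕ+} {H : Type*} [AddCommGroup H] [Module L H]
    (t : H ⊗[L] VSpace L k) :
    ∃ φ : Fin k → H, t = ∑ j : Fin k, φ j ⊗ₜ[L] mono k j ((k : ℕ) - 1 - j) (by omega) := by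
  induction t with
  | zero => exact ⟨0, by simp⟩
  | add s t hs ht =>
    obtain ⟨φ, rfl⟩ := hs
    obtain ⟨ψ, rfl⟩ := ht
    exact ⟨φ + ψ, by simp [TensorProduct.add_tmul, Finset.sum_add_distrib]⟩
  | tmul x v =>
    induction v using VSpace.induction with
    | h0 => exact ⟨0, by simp⟩
    | hadd v w hv hw =>
      obtain ⟨φ, hφ⟩ := hv
      obtain ⟨ψ, hψ⟩ := hw
      exact ⟨φ + ψ, by simp [TensorProduct.tmul_add, hφ, hψ, TensorProduct.add_tmul,
        Finset.sum_add_distrib]⟩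
    | hsmul a v hv =>
      obtain ⟨φ, hφ⟩ := hv
      refine ⟨a • φ, ?_⟩
      rw [TensorProduct.tmul_smul, hφ, Finset.smul_sum]
      rfl
    | hmono i m h =>
      have hk := k.pos
      refine ⟨Pi.single ⟨i, by omega⟩ x, ?_⟩
      obtain rfl : m = (k : ℕ) - 1 - i := by omega
      rw [Finset.sum_eq_single ⟨i, by omega⟩]
      · simp
      · intro j _ hj
        rw [Pi.single_eq_of_ne hj, TensorProduct.zero_tmul]
      · simp

/-- The highest weight argument for injectivity: the unipotent matrices isolate the components of
highest degree, and a torus element separates the powers of the determinant. -/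
theorem injective_evalMap (ρ : Representation L (K p) E) : Function.Injective (evalMap ρ) := by
  classical
  have := charZero p L
  rw [injective_iff_map_eq_zero]
  intro t ht
  by_contra hne
  choose φ hφ using fun i => exists_eq_sum_tmul_mono (t i)
  let m : (i : ℤ × ℕ+) → Fin i.2 → VSpace L i.2 := fun i j =>
    mono i.2 j ((i.2 : ℕ) - 1 - j) (by omega)
  let s := DFinsupp.support t
  have hs : s.Nonempty := by
    rw [Finset.nonempty_iff_ne_empty]
    exact fun h => hne (DFinsupp.support_eq_empty.mp h)
  have hsum : ∑ i ∈ s, ∑ j, φ i j (m i j) = 0 := by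
    rw [← ht]
    conv_rhs => rw [← DirectSum.sum_support_of t, map_sum]
    refine Finset.sum_congr rfl fun i _ => ?_
    conv_rhs => rw [hφ i, map_sum, map_sum]
    exact Finset.sum_congr rfl fun j _ => (evalMap_lof_tmul i _ _).symm
  obtain ⟨i₀, hi₀, hmax⟩ := Finset.exists_max_image s (fun i => i.2) hs
  have hact : ∀ g : K p, ∀ v : (i : ℤ × ℕ+) → Fin i.2 → VSpace L i.2,
      ∑ i ∈ s, ∑ j, φ i j (v i j) = 0 →
        ∑ i ∈ s, ∑ j, φ i j (V L i.1 i.2 (incl p L g) (v i j)) = 0 := by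
    intro g v hv
    have h := congrArg (ρ g) hv
    simp only [map_sum, map_zero] at h
    rw [← h]
    exact Finset.sum_congr rfl fun i _ => Finset.sum_congr rfl fun j _ =>
      (φ i j).isIntertwining _ _ g _
  let ψ : (c : ℕ) → (i : ℤ × ℕ+) → HomV ρ i := fun c i => ∑ j : Fin i.2, (c : L) ^ (j : ℕ) • φ i j
  let s₀ := s.filter fun i => i.2 = i₀.2
  -- the coefficient of `b^(n - 1)`, for `n = i₀.2`, after the action of `(1 b; 0 1) (1 0; c 1)`
  have hψsum : ∀ c, ∑ i ∈ s₀, ψ c i (highest L i.2) = 0 := by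
    intro c
    choose w hw₁ hw₂ hw₃ using fun (i : ℤ × ℕ+) (j : Fin i.2) =>
      exists_upperUnipotent_expansion (p := p) i.1 i.2
        (V L i.1 i.2 (incl p L (lowerUnipotent p c)) (m i j))
    have hpoly : ∀ b : ℕ, ∑ r : Fin i₀.2, (b : L) ^ (r : ℕ) •
        (∑ i ∈ s, ∑ j, φ i j (w i j r)) = 0 := by
      intro b
      rw [← hact (upperUnipotent p b) _ (hact (lowerUnipotent p c) m hsum)]
      simp only [Finset.smul_sum]
      rw [Finset.sum_comm]
      refine Finset.sum_congr rfl fun i hi => ?_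
      rw [Finset.sum_comm]
      refine Finset.sum_congr rfl fun j _ => ?_
      rw [hw₃ i j b i₀.2 (hmax i hi), map_sum]
      exact Finset.sum_congr rfl fun r _ => (map_smul (φ i j) _ _).symm
    have hk := i₀.2.pos
    have htop := eq_zero_of_sum_natCast_pow_smul_eq_zero hpoly ⟨(i₀.2 : ℕ) - 1, by omega⟩
    rw [← htop, Finset.sum_filter]
    refine Finset.sum_congr rfl fun i hi => ?_
    split_ifs with h
    · rw [Representation.IntertwiningMap.sum_apply]
      refine Finset.sum_congr rfl fun j _ => ?_
      change _ = φ i j (w i j ((i₀.2 : ℕ) - 1))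
      rw [← h, hw₂, evalY_lowerUnipotent_mono, map_smul]
      rfl
    · have hlt : (i.2 : ℕ) < i₀.2 := lt_of_le_of_ne (hmax i hi) fun h' => h (PNat.eq h')
      refine (Finset.sum_eq_zero fun j _ => ?_).symm
      change φ i j (w i j ((i₀.2 : ℕ) - 1)) = 0
      rw [hw₁ i j ((i₀.2 : ℕ) - 1) (by omega), map_zero]
  -- for `i ∈ s₀` the degree is fixed, so the eigenvalue `(1 + p)^l` determines `i`
  have hψ : ∀ c, ψ c i₀ = 0 := fun c => by
    refine homV_eq_zero_of_apply_highest _ ?_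
    refine eq_zero_of_sum_eigenvectors_eq_zero (ρ (torusElement p)) s₀
      (fun i => ((p + 1 : ℕ) : L) ^ i.1) ?_ (fun i => ψ c i (highest L i.2)) ?_ (hψsum c) i₀
      (by simp [s₀, hi₀])
    · intro i hi i' hi' h
      simp only [s₀, Finset.coe_filter, Set.mem_ofPred_eq] at hi hi'
      exact Prod.ext (zpow_natCast_succ_injective p L h) (hi.2.trans hi'.2.symm)
    · intro i _
      rw [← (ψ c i).isIntertwining]
      change ψ c i (V L i.1 i.2 (incl p L (torusElement p)) (highest L i.2)) = _
      rw [torusElement_highest, map_smul]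
  have hφ₀ : ∀ j, φ i₀ j = 0 := eq_zero_of_sum_natCast_pow_smul_eq_zero hψ
  refine DFinsupp.mem_support_iff.mp hi₀ ?_
  rw [hφ i₀]
  exact Finset.sum_eq_zero fun j _ => by rw [hφ₀ j, TensorProduct.zero_tmul]

end Independence

end KAlg

theorem mainTheorem5 {p : ℕ} [Fact p.Prime] {L : Type*} [NontriviallyNormedField L]
    [NormedAlgebra ℚ_[p] L] [FiniteDimensional ℚ_[p] L]
    {E : Type*} [NormedAddCommGroup E] [NormedSpace L E] [CompleteSpace E] [IsUltrametricDist E]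
    (ρ : Representation L (KAlg.K p) E) (hρ : KAlg.IsUnitaryRep ρ)
    (r : ℕ) (hE : KAlg.IsSummandOfRegular ρ r) :
    Function.Injective (KAlg.evalMap ρ) ∧
    (LinearMap.range (KAlg.evalMap ρ) : Set E) = {v | KAlg.IsAlgebraicVector ρ v} ∧
    Dense (LinearMap.range (KAlg.evalMap ρ) : Set E) ∧
    ∀ (l : ℤ) (k : ℕ+), FiniteDimensional L (KAlg.HomV ρ (l, k)) := by
  have : CompleteSpace L := FiniteDimensional.complete ℚ_[p] L
  obtain ⟨S, T, hT, hTS⟩ := hE.exists_retraction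
  refine ⟨KAlg.injective_evalMap ρ, Set.Subset.antisymm ?_ ?_, ?_, fun l k => ?_⟩
  · exact fun v hv => KAlg.isAlgebraicVector_of_mem_range hv
  · intro v hv
    rw [← hTS v]
    exact KAlg.map_mem_range_evalMap T
      (KAlg.mem_range_evalMap_of_isAlgebraicVector (KAlg.IsAlgebraicVector.map S hv))
  · have hsurj : Function.Surjective T := fun v => ⟨S v, hTS v⟩
    refine (hsurj.denseRange.dense_image hT (KAlg.dense_range_evalMap_rightRegPow r)).mono ?_
    rintro _ ⟨F, hF, rfl⟩
    exact KAlg.map_mem_range_evalMap T hF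
  · exact KAlg.finiteDimensional_homV_of_injective S
      (Function.LeftInverse.injective (g := T) hTS) (l, k)
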